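/- Let $k\ge 1$ and let $V$ be a finite set with $|V|=n\ge 2k$. Write $V^{(k)}$ for the set of $k$-element subsets of $V$. A weighted $k$-uniform hypergraph on $V$ is a function $w:V^{(k)}\to\mathbb R$; put $w(V)=\sum_{e\in V^{(k)}}w(e)$, $d(w)=w(V)/\binom nk$, $\langle w,u\rangle=\sum_{e\in V^{(k)}}w(e)u(e)$, and for a permutation $\pi$ of $V$ let $w_\pi(e)=w(\pi^{-1}e)$. The discrepancy of a pair is $$\mathrm{disc}(w,u)=\max_{\pi\in S(V)}\Bigl|\langle w_\pi,u\rangle-d(w)d(u)\binom nk\Bigr|.$$ Fix distinct vertices $x_1,y_1,\dots,x_k,y_k$ of $V$. For $0\le i\le k$ define $\phi_i:V^{(k)}\to\mathbb R$ by $\phi_i(A)=(-1)^{|A\cap\{y_1,\dots,y_i\}|}$ if $|A\cap\{x_j,y_j\}|=1$ for all $1\le j\le i$, and $\phi_i(A)=0$ otherwise, and let $V_i\subseteq\mathbb R^{V^{(k)}}$ be the linear span of $\{(\phi_i)_\pi:\pi\in S(V)\}$ (this does not depend on the choice of the vertices $x_j,y_j$). Let $u_1,\dots,u_k$ be nonzero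 weighted $k$-uniform hypergraphs on $V$. If $u_i(V)=0$ for all $i$ and $\mathrm{disc}(u_i,u_j)=0$ for all $1\le i<j\le k$, then there is a permutation $\sigma$ of $\{1,\dots,k\}$ such that $u_{\sigma(i)}\in V_i$ for every $1\le i\le k$. Conversely, if there is such a permutation $\sigma$, then $u_i(V)=0$ for all $i$ and $\mathrm{disc}(u_i,u_j)=0$ for all $1\le i<j\le k$. -/

import Mathlib

open scoped Pointwise

noncomputable section

/-- A weighted `k`-uniform hypergraph with vertex set `V`: a real weight on each `k`-subset. -/
abbrev WeightedHypergraph (V : Type*) (k : ℕ) : Type _ := Set.powersetCard V k → ℝ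

namespace WeightedHypergraph

variable {V : Type*} [Fintype V] [DecidableEq V] {k : ℕ}

/-- The total weight `w(V)`. -/
def total (w : WeightedHypergraph V k) : ℝ := ∑ e, w e

/-- The density `d(w) = w(V) / (n choose k)`, where `n = |V|`. -/
def density (w : WeightedHypergraph V k) : ℝ :=
  w.total / ((Fintype.card V).choose k : ℝ)

/-- The intersection `⟨w, u⟩`. -/
def inter (w u : WeightedHypergraph V k) : ℝ := ∑ e, w e * u e

/-- The action of a permutation of `V` on weighted hypergraphs: `w_π(e) = w(π⁻¹ e)`. -/
def permute (π : Equiv.Perm V) (w : WeightedHypergraph V k) : WeightedHypergraph V k :=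
  fun e => w (π⁻¹ • e)

/-- The discrepancy of a pair:
`disc(w, u) = max_π |⟨w_π, u⟩ - d(w) d(u) (n choose k)|`. -/
def disc (w u : WeightedHypergraph V k) : ℝ :=
  Finset.univ.sup' Finset.univ_nonempty fun π : Equiv.Perm V =>
    |inter (permute π w) u - w.density * u.density * ((Fintype.card V).choose k : ℝ)|

/-- The weighting `φ_i` attached to a sequence of `2k` distinct vertices
`x_1, y_1, …, x_k, y_k`, where `x_{j+1} = s (inl j)` and `y_{j+1} = s (inr j)`:
`φ_i(A) = (-1)^|A ∩ {y_1, …, y_i}|` if `A` contains exactly one of `x_j, y_j` for each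
`1 ≤ j ≤ i`, and `φ_i(A) = 0` otherwise. -/
def phi (s : Fin k ⊕ Fin k ↪ V) (i : Fin (k + 1)) : WeightedHypergraph V k := fun A =>
  if ∀ j : Fin k, (j : ℕ) < i → ((A : Finset V) ∩ {s (Sum.inl j), s (Sum.inr j)}).card = 1 then
    (-1) ^ ((A : Finset V) ∩
      (Finset.univ.filter fun j : Fin k => (j : ℕ) < i).image fun j => s (Sum.inr j)).card
  else 0

/-- The subspace `V_i`: the linear span of all the images of `φ_i` under permutations of `V`. -/
def phiSpan (s : Fin k ⊕ Fin k ↪ V) (i : Fin (k + 1)) : Submodule ℝ (WeightedHypergraph V k) :=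
  Submodule.span ℝ (Set.range fun π : Equiv.Perm V => permute π (phi s i))

end WeightedHypergraph

end

/-!
A weighting of total weight zero has discrepancy zero with another one exactly when the
subrepresentations they generate are orthogonal. Up to a scalar, `φ_i` is determined by its
symmetries: it changes sign when `x_j` and `y_j` are exchanged for `j ≤ i`, and it is symmetric in
the remaining vertices, and these transpositions move every edge of the support to
`{x_1, …, x_k}`. Orthogonal projections onto invariant subspaces preserve symmetries, so an invariant
subspace either contains `φ_i` or is orthogonal to `V_i`.

A nonzero weighting `w` generates some `φ_i`: if `w` alternates on the first `i` pairs and is not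
symmetric in the remaining vertices, then antisymmetrising a translate of `w` over the next pair
gives a nonzero weighting alternating on `i + 1` pairs. The `V_i` are pairwise orthogonal, because
`φ_i` has degree at most `i` in the vertex indicators and is orthogonal to all weightings of smaller
degree. So `k` pairwise orthogonal nonzero invariant subspaces orthogonal to `V_0` each contain
exactly one of `φ_1, …, φ_k`, and each lies in the corresponding `V_i`.
-/

section OrbitSpan

variable {R G M : Type*} [CommSemiring R] [Monoid G] [AddCommMonoid M] [Module R M]
  {ρ : Representation R G M} {W : Submodule R M}

/-- The subrepresentation of `ρ` generated by the single vector `v`; the spaces `V_i` are of this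
form. -/
def orbitSpan (ρ : Representation R G M) (v : M) : Submodule R M :=
  Submodule.span R (Set.range fun g => ρ g v)

theorem apply_mem_of_mem_invtSubmodule (hW : W ∈ ρ.invtSubmodule) (g : G) {v : M} (hv : v ∈ W) :
    ρ g v ∈ W :=
  ρ.mem_invtSubmodule.1 hW g hv

theorem apply_mem_orbitSpan (ρ : Representation R G M) (g : G) (v : M) : ρ g v ∈ orbitSpan ρ v :=
  Submodule.subset_span ⟨g, rfl⟩

theorem self_mem_orbitSpan (ρ : Representation R G M) (v : M) : v ∈ orbitSpan ρ v := by
  simpa using apply_mem_orbitSpan ρ 1 v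

theorem span_mem_invtSubmodule {S : Set M} (hS : ∀ g, ∀ v ∈ S, ρ g v ∈ S) :
    Submodule.span R S ∈ ρ.invtSubmodule := by
  refine ρ.mem_invtSubmodule.2 fun g => (Module.End.mem_invtSubmodule _).2 ?_
  exact Submodule.span_le.2 fun v hv => Submodule.subset_span (hS g v hv)

theorem orbitSpan_mem_invtSubmodule (ρ : Representation R G M) (v : M) :
    orbitSpan ρ v ∈ ρ.invtSubmodule := by
  refine span_mem_invtSubmodule ?_
  rintro g _ ⟨h, rfl⟩
  exact ⟨g * h, by simp⟩

theorem orbitSpan_le_iff (hW : W ∈ ρ.invtSubmodule) {v : M} : orbitSpan ρ v ≤ W ↔ v ∈ W := by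
  refine ⟨fun h => h (self_mem_orbitSpan ρ v), fun hv => Submodule.span_le.2 ?_⟩
  rintro _ ⟨g, rfl⟩
  exact apply_mem_of_mem_invtSubmodule hW g hv

end OrbitSpan

section InvariantForm

variable {R M : Type*} [CommRing R] [AddCommGroup M] [Module R M]

theorem le_orthogonal_comm {B : LinearMap.BilinForm R M} (hB : B.IsRefl) {W W' : Submodule R M} :
    W ≤ B.orthogonal W' ↔ W' ≤ B.orthogonal W :=
  ⟨fun h _ hv' _ hv => hB _ _ (h hv _ hv'), fun h _ hv _ hv' => hB _ _ (h hv' _ hv)⟩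

theorem orthogonal_mem_invtSubmodule {G : Type*} [Group G] {ρ : Representation R G M}
    {B : LinearMap.BilinForm R M} (hB : ∀ g v w, B (ρ g v) (ρ g w) = B v w) {W : Submodule R M}
    (hW : W ∈ ρ.invtSubmodule) : B.orthogonal W ∈ ρ.invtSubmodule := by
  refine ρ.mem_invtSubmodule.2 fun g p hp v hv => ?_
  have hv' : B (ρ g⁻¹ v) p = 0 := hp _ (apply_mem_of_mem_invtSubmodule hW g⁻¹ hv)
  rwa [← hB g, ρ.self_inv_apply] at hv'

theorem mem_eigenspace_of_add_mem_eigenspace {T : Module.End R M} {μ : R} {W W' : Submodule R M}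
    (hW : W ∈ T.invtSubmodule) (hW' : W' ∈ T.invtSubmodule) (hdisj : Disjoint W W') {w w' : M}
    (hw : w ∈ W) (hw' : w' ∈ W') (h : w + w' ∈ T.eigenspace μ) : w ∈ T.eigenspace μ := by
  rw [Module.End.mem_eigenspace_iff, map_add, smul_add] at h
  have heq : T w - μ • w = μ • w' - T w' := by rw [sub_eq_sub_iff_add_eq_add, h, add_comm]
  have hmem : T w - μ • w ∈ W := sub_mem (hW hw) (W.smul_mem μ hw)
  have hmem' : T w - μ • w ∈ W' := heq ▸ sub_mem (W'.smul_mem μ hw') (hW' hw')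
  exact Module.End.mem_eigenspace_iff.2
    (sub_eq_zero.1 (Submodule.disjoint_def.1 hdisj _ hmem hmem'))

end InvariantForm

theorem mem_of_mem_span_singleton_of_ne_zero {K E : Type*} [DivisionRing K] [AddCommGroup E]
    [Module K E] {W : Submodule K E} {v x : E} (hv : v ∈ W) (hv0 : v ≠ 0)
    (hvx : v ∈ Submodule.span K {x}) : x ∈ W := by
  obtain ⟨c, rfl⟩ := Submodule.mem_span_singleton.1 hvx
  exact (Submodule.smul_mem_iff W (left_ne_zero_of_smul hv0)).1 hv

theorem swap_smul_finset_eq_self {V : Type*} [DecidableEq V] {A : Finset V} {a b : V}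
    (h : a ∈ A ↔ b ∈ A) : Equiv.swap a b • A = A := by
  ext c
  rw [← Finset.inv_smul_mem_iff, Equiv.swap_inv, Equiv.Perm.smul_def, Equiv.swap_apply_def]
  split_ifs with hca hcb
  · rw [hca, h]
  · rw [hcb, h]
  · rfl

theorem swap_smul_finset_sdiff_ssubset {V : Type*} [DecidableEq V] {A B : Finset V} {a b : V}
    (ha : a ∈ A) (haB : a ∉ B) (hb : b ∉ A) (hbB : b ∈ B) :
    (Equiv.swap a b • A) \ B ⊂ A \ B := by
  have hmem : ∀ c, c ∈ Equiv.swap a b • A ↔ Equiv.swap a b c ∈ A := fun c => by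
    rw [← Finset.inv_smul_mem_iff, Equiv.swap_inv, Equiv.Perm.smul_def]
  refine (Finset.ssubset_iff_of_subset fun c hc => ?_).2 ⟨a, by simp [ha, haB], by simp [hmem, hb]⟩
  obtain ⟨hcA, hcB⟩ := Finset.mem_sdiff.1 hc
  refine Finset.mem_sdiff.2 ⟨?_, hcB⟩
  have hcb : c ≠ b := fun h => hcB (h ▸ hbB)
  rcases eq_or_ne c a with rfl | hca
  · exact ha
  · rwa [hmem, Equiv.swap_apply_of_ne_of_ne hca hcb] at hcA

namespace WeightedHypergraph

section Inter

variable {V : Type*} [Fintype V] {k : ℕ}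

/-- The intersection `⟨w, u⟩` as a bilinear form. -/
def interForm : LinearMap.BilinForm ℝ (WeightedHypergraph V k) := dotProductBilin ℝ ℝ

theorem interForm_apply (w u : WeightedHypergraph V k) : interForm w u = inter w u := rfl

theorem isRefl_interForm :
    (interForm : LinearMap.BilinForm ℝ (WeightedHypergraph V k)).IsRefl := fun w u h => by
  rw [← h]
  exact dotProduct_comm u w

theorem disjoint_orthogonal (W : Submodule ℝ (WeightedHypergraph V k)) :
    Disjoint W (interForm.orthogonal W) :=
  Submodule.disjoint_def.2 fun w hw hw' => dotProduct_self_eq_zero.1 (hw' w hw)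

theorem isCompl_orthogonal (W : Submodule ℝ (WeightedHypergraph V k)) :
    IsCompl W (interForm.orthogonal W) :=
  (LinearMap.BilinForm.isCompl_orthogonal_iff_disjoint isRefl_interForm).2 (disjoint_orthogonal W)

end Inter

section Permute

variable {V : Type*} [DecidableEq V] {k : ℕ}

/-- The action of the permutations of `V` on weighted hypergraphs as a linear representation. -/
def permuteRep : Representation ℝ (Equiv.Perm V) (WeightedHypergraph V k) where
  toFun π :=
    { toFun := permute π
      map_add' := fun _ _ => rfl
      map_smul' := fun _ _ => rfl }
  map_one' := LinearMap.ext fun w => funext fun e =>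
    congrArg w (show (1 : Equiv.Perm V)⁻¹ • e = e by simp)
  map_mul' π τ := LinearMap.ext fun w => funext fun e =>
    congrArg w (show (π * τ)⁻¹ • e = τ⁻¹ • π⁻¹ • e by rw [mul_inv_rev, mul_smul])

theorem permuteRep_apply (π : Equiv.Perm V) (w : WeightedHypergraph V k) :
    permuteRep π w = permute π w := rfl

theorem permuteRep_swap_apply (a b : V) (w : WeightedHypergraph V k) (A : Set.powersetCard V k) :
    permuteRep (Equiv.swap a b) w A = w (Equiv.swap a b • A) := by
  simp [permuteRep_apply, permute]

theorem interForm_permuteRep [Fintype V] (π : Equiv.Perm V) (w u : WeightedHypergraph V k) :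
    interForm (permuteRep π w) (permuteRep π u) = interForm w u :=
  Equiv.sum_comp (MulAction.toPerm π⁻¹) fun e => w e * u e

theorem orthogonal_interForm_mem_invtSubmodule [Fintype V]
    {W : Submodule ℝ (WeightedHypergraph V k)} (hW : W ∈ permuteRep.invtSubmodule) :
    interForm.orthogonal W ∈ permuteRep.invtSubmodule :=
  orthogonal_mem_invtSubmodule interForm_permuteRep hW

theorem disc_eq_zero_iff [Fintype V] {w u : WeightedHypergraph V k} (hw : w.total = 0) :
    disc w u = 0 ↔
      orbitSpan permuteRep w ≤ interForm.orthogonal (orbitSpan permuteRep u) := by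
  have hdisc : disc w u = 0 ↔ ∀ π, interForm (permuteRep π w) u = 0 := by
    have hd : w.density = 0 := by simp [density, hw]
    simp only [disc, hd, zero_mul, sub_zero, interForm_apply, permuteRep_apply]
    refine ⟨fun h π => abs_nonpos_iff.1 (h ▸ ?_), fun h => by simp [h]⟩
    exact Finset.le_sup' (fun π => |inter (permute π w) u|) (Finset.mem_univ π)
  have hinv := orthogonal_interForm_mem_invtSubmodule
    (orbitSpan_mem_invtSubmodule permuteRep w)
  rw [hdisc, le_orthogonal_comm isRefl_interForm, orbitSpan_le_iff hinv]
  refine ⟨fun h v hv => ?_, fun h π => h _ (apply_mem_orbitSpan _ _ _)⟩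
  refine isRefl_interForm _ _ (Submodule.span_le.2 ?_ hv : v ∈ LinearMap.ker (interForm u))
  rintro _ ⟨π, rfl⟩
  exact isRefl_interForm _ _ (h π)

end Permute

section Containing

variable {V : Type*} [DecidableEq V] {k : ℕ}

/-- The indicator weighting of the edges that contain the vertex set `B`. -/
def containing (k : ℕ) (B : Finset V) : WeightedHypergraph V k := fun A =>
  if B ⊆ (A : Finset V) then 1 else 0

theorem containing_empty : containing k (∅ : Finset V) = 1 := by
  ext A
  simp [containing]

theorem containing_mul_containing (B C : Finset V) :
    containing k B * containing k C = containing k (B ∪ C) := by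
  ext A
  simp only [Pi.mul_apply, containing, Finset.union_subset_iff, ite_and, ite_mul, one_mul,
    zero_mul]

theorem permuteRep_containing (π : Equiv.Perm V) (B : Finset V) :
    permuteRep π (containing k B) = containing k (π • B) := by
  ext A
  simp [permuteRep_apply, permute, containing, Finset.subset_smul_finset_iff]

theorem containing_singleton_sub_apply {x y : V} (hxy : x ≠ y) (A : Set.powersetCard V k) :
    (containing k {x} - containing k {y}) A =
      if ((A : Finset V) ∩ {x, y}).card = 1 then
        (if y ∈ (A : Finset V) then (-1 : ℝ) else 1) else 0 := by
  by_cases hx : x ∈ (A : Finset V) <;> by_cases hy : y ∈ (A : Finset V) <;>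
    simp [containing, hx, hy, hxy, Finset.inter_insert_of_mem, Finset.inter_insert_of_notMem]

/-- The weightings of degree at most `m`, as polynomials in the vertex indicators
`containing k {a}`. -/
def degreeLE (V : Type*) [DecidableEq V] (k m : ℕ) : Submodule ℝ (WeightedHypergraph V k) :=
  Submodule.span ℝ (containing k '' {B | B.card ≤ m})

theorem containing_mem_degreeLE {B : Finset V} {m : ℕ} (hB : B.card ≤ m) :
    containing k B ∈ degreeLE V k m :=
  Submodule.subset_span ⟨B, hB, rfl⟩

instance gradedMonoid_degreeLE : SetLike.GradedMonoid (degreeLE V k) where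
  one_mem := containing_empty (V := V) (k := k) ▸ containing_mem_degreeLE (by simp)
  mul_mem m n f g hf hg := by
    have hfg := Submodule.mul_mem_mul hf hg
    rw [degreeLE, degreeLE, Submodule.span_mul_span] at hfg
    refine Submodule.span_le.2 ?_ hfg
    rintro _ ⟨_, ⟨B, hB, rfl⟩, _, ⟨C, hC, rfl⟩, rfl⟩
    dsimp only
    rw [containing_mul_containing]
    exact containing_mem_degreeLE ((Finset.card_union_le B C).trans (add_le_add hB hC))

theorem degreeLE_mem_invtSubmodule (m : ℕ) : degreeLE V k m ∈ permuteRep.invtSubmodule := by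
  refine span_mem_invtSubmodule ?_
  rintro π _ ⟨B, hB, rfl⟩
  exact ⟨π • B, by simpa using hB, (permuteRep_containing π B).symm⟩

end Containing

section Pairs

variable {V : Type*} {k : ℕ} (s : Fin k ⊕ Fin k ↪ V)

/-- The edge `{x_1, …, x_k}`, on which every `φ_i` takes the value `1`. -/
def baseEdge : Set.powersetCard V k :=
  Set.powersetCard.ofFinEmb k V (Function.Embedding.inl.trans s)

theorem mem_baseEdge {a : V} : a ∈ (baseEdge s : Finset V) ↔ ∃ j, s (Sum.inl j) = a :=
  Set.powersetCard.mem_ofFinEmb_iff_mem_range _ _ _ _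

/-- The vertices outside the first `i` pairs `{x_j, y_j}`. -/
def outsidePairs (i : ℕ) : Set V :=
  {a | ∀ j : Fin k, (j : ℕ) < i → a ≠ s (Sum.inl j) ∧ a ≠ s (Sum.inr j)}

theorem exists_pair_disjoint_of_card_lt {B : Finset V} {m : ℕ} (hm : m ≤ k) (hB : B.card < m) :
    ∃ l : Fin k, (l : ℕ) < m ∧ s (Sum.inl l) ∉ B ∧ s (Sum.inr l) ∉ B := by
  by_contra! h
  classical
  let pairs : Finset (Fin k) := {l | (l : ℕ) < m}
  have hcard : pairs.card ≤ (pairs.biUnion fun l => B ∩ {s (Sum.inl l), s (Sum.inr l)}).card := by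
    refine Finset.card_le_card_biUnion (fun l _ l' _ hne => ?_) fun l hl => ?_
    · simp only [Finset.disjoint_left, Finset.mem_inter, Finset.mem_insert, Finset.mem_singleton]
      rintro a ⟨-, rfl | rfl⟩ <;> simp [hne]
    · by_cases hx : s (Sum.inl l) ∈ B
      · exact ⟨s (Sum.inl l), by simp [hx]⟩
      · exact ⟨s (Sum.inr l), by simp [h l (Finset.mem_filter.1 hl).2 hx]⟩
  have hsub : (pairs.biUnion fun l => B ∩ {s (Sum.inl l), s (Sum.inr l)}) ⊆ B :=
    Finset.biUnion_subset.2 fun l _ => Finset.inter_subset_left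
  have hpairs : pairs.card = m := by simp [pairs, Fin.card_filter_val_lt, hm]
  exact (hpairs ▸ hcard.trans (Finset.card_le_card hsub)).not_gt hB

variable {s} {i : ℕ}

theorem inl_mem_outsidePairs {l : Fin k} (hl : i ≤ (l : ℕ)) : s (Sum.inl l) ∈ outsidePairs s i :=
  fun j hj => ⟨by simp [Fin.ext_iff, (hj.trans_le hl).ne'], by simp⟩

theorem inr_mem_outsidePairs {l : Fin k} (hl : i ≤ (l : ℕ)) : s (Sum.inr l) ∈ outsidePairs s i :=
  fun j hj => ⟨by simp, by simp [Fin.ext_iff, (hj.trans_le hl).ne']⟩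

end Pairs

section Phi

variable {V : Type*} [DecidableEq V] {k : ℕ} (s : Fin k ⊕ Fin k ↪ V)

theorem phi_eq_prod (i : Fin (k + 1)) :
    phi s i = ∏ j ∈ Finset.univ.filter fun j : Fin k => (j : ℕ) < i,
      (containing k {s (Sum.inl j)} - containing k {s (Sum.inr j)}) := by
  ext A
  have hinj : Function.Injective fun j => s (Sum.inr j) := s.injective.comp Sum.inr_injective
  have hne (j : Fin k) : s (Sum.inl j) ≠ s (Sum.inr j) := by simp
  simp only [Finset.prod_apply, containing_singleton_sub_apply (hne _), Finset.prod_ite_zero,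
    Finset.mem_filter_univ, phi]
  congr 1
  rw [← Finset.prod_const, Finset.inter_comm, ← Finset.prod_ite_mem,
    Finset.prod_image hinj.injOn]

theorem permuteRep_phi (π : Equiv.Perm V) (i : Fin (k + 1)) :
    permuteRep π (phi s i) = phi (s.trans π.toEmbedding) i := by
  have hfactor (a : V) (A : Set.powersetCard V k) :
      containing k {a} (π⁻¹ • A) = containing k {π a} A := by
    rw [← Equiv.Perm.smul_def, ← Finset.smul_finset_singleton, ← permuteRep_containing]
    rfl
  ext A
  simp only [permuteRep_apply, permute, phi_eq_prod, Finset.prod_apply, Pi.sub_apply, hfactor,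
    Function.Embedding.trans_apply, Equiv.coe_toEmbedding]

theorem phi_zero : phi s 0 = 1 := by simp [phi_eq_prod]

theorem phi_baseEdge (i : Fin (k + 1)) : phi s i (baseEdge s) = 1 := by
  rw [phi_eq_prod, Finset.prod_apply]
  exact Finset.prod_eq_one fun j _ => by simp [containing, mem_baseEdge]

theorem phi_ne_zero (i : Fin (k + 1)) : phi s i ≠ 0 := fun h => by
  simpa [h] using phi_baseEdge s i

theorem phi_mem_degreeLE (i : Fin (k + 1)) : phi s i ∈ degreeLE V k i := by
  rw [phi_eq_prod]
  have hprod := SetLike.prod_mem_graded (degreeLE V k) (F := {j : Fin k | (j : ℕ) < i}) (fun _ => 1)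
    (fun j => containing k {s (Sum.inl j)} - containing k {s (Sum.inr j)}) fun j _ =>
      sub_mem (containing_mem_degreeLE (by simp)) (containing_mem_degreeLE (by simp))
  simpa [Fin.card_filter_val_lt, Nat.lt_succ_iff.1 i.2] using hprod

theorem phiSpan_mem_invtSubmodule (i : Fin (k + 1)) : phiSpan s i ∈ permuteRep.invtSubmodule :=
  orbitSpan_mem_invtSubmodule permuteRep (phi s i)

theorem phi_mem_phiSpan (i : Fin (k + 1)) : phi s i ∈ phiSpan s i :=
  self_mem_orbitSpan permuteRep (phi s i)

theorem phiSpan_le_iff {s} {W : Submodule ℝ (WeightedHypergraph V k)}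
    {i : Fin (k + 1)} (hW : W ∈ permuteRep.invtSubmodule) :
    phiSpan s i ≤ W ↔ phi s i ∈ W := by
  change orbitSpan permuteRep (phi s i) ≤ W ↔ _
  exact orbitSpan_le_iff hW

/-- The weightings that change sign when `x_j` and `y_j` are exchanged, for each of the first `i`
pairs. -/
def pairAlternating (i : ℕ) : Submodule ℝ (WeightedHypergraph V k) :=
  ⨅ j : Fin k, ⨅ _ : (j : ℕ) < i,
    Module.End.eigenspace (permuteRep (Equiv.swap (s (Sum.inl j)) (s (Sum.inr j)))) (-1)

/-- The weightings symmetric in the vertices outside the first `i` pairs. Only transpositions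
moving some later `x_l` are imposed: they generate all others if `i < k`, and for `i = k`, where
being alternating already determines the weighting up to a scalar, there is no condition. -/
def outsideSymmetric (i : ℕ) : Submodule ℝ (WeightedHypergraph V k) :=
  ⨅ l : Fin k, ⨅ _ : i ≤ (l : ℕ), ⨅ a ∈ outsidePairs s i,
    Module.End.eigenspace (permuteRep (Equiv.swap (s (Sum.inl l)) a)) 1

variable {s} {i : ℕ} {w : WeightedHypergraph V k}

theorem mem_pairAlternating : w ∈ pairAlternating s i ↔
    ∀ j : Fin k, (j : ℕ) < i → permuteRep (Equiv.swap (s (Sum.inl j)) (s (Sum.inr j))) w = -w := by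
  simp [pairAlternating, Submodule.mem_iInf]

theorem mem_outsideSymmetric : w ∈ outsideSymmetric s i ↔ ∀ l : Fin k, i ≤ (l : ℕ) →
    ∀ a ∈ outsidePairs s i, permuteRep (Equiv.swap (s (Sum.inl l)) a) w = w := by
  simp [outsideSymmetric, Submodule.mem_iInf]

theorem swap_apply_inl {a b : V} (ha : a ∈ outsidePairs s i) (hb : b ∈ outsidePairs s i)
    {j : Fin k} (hj : (j : ℕ) < i) : Equiv.swap a b (s (Sum.inl j)) = s (Sum.inl j) :=
  Equiv.swap_apply_of_ne_of_ne (ha j hj).1.symm (hb j hj).1.symm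

theorem swap_apply_inr {a b : V} (ha : a ∈ outsidePairs s i) (hb : b ∈ outsidePairs s i)
    {j : Fin k} (hj : (j : ℕ) < i) : Equiv.swap a b (s (Sum.inr j)) = s (Sum.inr j) :=
  Equiv.swap_apply_of_ne_of_ne (ha j hj).2.symm (hb j hj).2.symm

variable (s) in
theorem phi_mem_pairAlternating (i : Fin (k + 1)) : phi s i ∈ pairAlternating s i := by
  refine mem_pairAlternating.2 fun j hj => ?_
  have hmem : j ∈ Finset.univ.filter fun j : Fin k => (j : ℕ) < i := by simpa using hj
  rw [permuteRep_phi, phi_eq_prod, phi_eq_prod, ← Finset.mul_prod_erase _ _ hmem,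
    ← Finset.mul_prod_erase _ _ hmem, ← neg_mul]
  congr 1
  · simp
  · refine Finset.prod_congr rfl fun l hl => ?_
    have hlj : l ≠ j := Finset.ne_of_mem_erase hl
    simp [Equiv.swap_apply_of_ne_of_ne, hlj]

variable (s) in
theorem phi_mem_outsideSymmetric (i : Fin (k + 1)) : phi s i ∈ outsideSymmetric s i := by
  refine mem_outsideSymmetric.2 fun l hl a ha => ?_
  rw [permuteRep_phi, phi_eq_prod, phi_eq_prod]
  refine Finset.prod_congr rfl fun j hj => ?_
  have hj : (j : ℕ) < i := (Finset.mem_filter.1 hj).2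
  simp [swap_apply_inl (inl_mem_outsidePairs hl) ha hj,
    swap_apply_inr (inl_mem_outsidePairs hl) ha hj]

theorem apply_eq_zero_of_mem_pairAlternating (hw : w ∈ pairAlternating s i) {j : Fin k}
    (hj : (j : ℕ) < i) {A : Set.powersetCard V k}
    (hA : s (Sum.inl j) ∈ (A : Finset V) ↔ s (Sum.inr j) ∈ (A : Finset V)) : w A = 0 := by
  have hfix : Equiv.swap (s (Sum.inl j)) (s (Sum.inr j)) • A = A :=
    Subtype.ext (Set.powersetCard.coe_smul.trans (swap_smul_finset_eq_self hA))
  have h := congrFun (mem_pairAlternating.1 hw j hj) A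
  rw [permuteRep_swap_apply, hfix, Pi.neg_apply] at h
  exact self_eq_neg.1 h

theorem exists_apply_ne_zero_sdiff_baseEdge_ssubset (halt : w ∈ pairAlternating s i)
    (hsym : w ∈ outsideSymmetric s i) {A : Set.powersetCard V k} (hA : w A ≠ 0)
    (hne : A ≠ baseEdge s) : ∃ A' : Set.powersetCard V k,
      w A' ≠ 0 ∧ (A' \ baseEdge s : Finset V) ⊂ (A \ baseEdge s : Finset V) := by
  by_cases hy : ∃ j : Fin k, (j : ℕ) < i ∧ s (Sum.inr j) ∈ (A : Finset V)
  · obtain ⟨j, hj, hyA⟩ := hy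
    have hxA : s (Sum.inl j) ∉ (A : Finset V) := fun hxA =>
      hA (apply_eq_zero_of_mem_pairAlternating halt hj (iff_of_true hxA hyA))
    refine ⟨Equiv.swap (s (Sum.inr j)) (s (Sum.inl j)) • A, ?_, swap_smul_finset_sdiff_ssubset
      hyA (by simp [mem_baseEdge]) hxA (by simp [mem_baseEdge])⟩
    rw [Equiv.swap_comm, ← permuteRep_swap_apply _ _ w, mem_pairAlternating.1 halt j hj]
    exact neg_ne_zero.2 hA
  · push Not at hy
    obtain ⟨a, ha, haB⟩ := (Set.powersetCard.exists_mem_notMem_iff_ne _ _).1 hne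
    obtain ⟨b, hbB, hb⟩ := (Set.powersetCard.exists_mem_notMem_iff_ne _ _).1 hne.symm
    obtain ⟨l, rfl⟩ := (mem_baseEdge s).1 hbB
    have hl : i ≤ (l : ℕ) := by
      by_contra! hl
      exact hA (apply_eq_zero_of_mem_pairAlternating halt hl (iff_of_false hb (hy l hl)))
    have haO : a ∈ outsidePairs s i := fun j hj =>
      ⟨fun h => haB ((mem_baseEdge s).2 ⟨j, h.symm⟩), fun h => hy j hj (h ▸ ha)⟩
    refine ⟨Equiv.swap a (s (Sum.inl l)) • A, ?_, swap_smul_finset_sdiff_ssubset ha haB hb hbB⟩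
    rwa [Equiv.swap_comm, ← permuteRep_swap_apply _ _ w, mem_outsideSymmetric.1 hsym l hl a haO]

theorem eq_zero_of_apply_baseEdge_eq_zero (halt : w ∈ pairAlternating s i)
    (hsym : w ∈ outsideSymmetric s i) (h0 : w (baseEdge s) = 0) : w = 0 := by
  suffices h : ∀ (D : Finset V) (A : Set.powersetCard V k), (A \ baseEdge s : Finset V) = D →
      w A = 0 from funext fun A => h _ A rfl
  intro D
  induction D using Finset.strongInduction with
  | H D ih =>
    rintro A rfl
    by_contra hA
    obtain ⟨A', hA', hlt⟩ := exists_apply_ne_zero_sdiff_baseEdge_ssubset halt hsym hA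
      (by rintro rfl; exact hA h0)
    exact hA' (ih _ hlt A' rfl)

theorem mem_span_phi {i : Fin (k + 1)} (halt : w ∈ pairAlternating s i)
    (hsym : w ∈ outsideSymmetric s i) : w ∈ Submodule.span ℝ {phi s i} := by
  refine Submodule.mem_span_singleton.2 ⟨w (baseEdge s), (sub_eq_zero.1 ?_).symm⟩
  refine eq_zero_of_apply_baseEdge_eq_zero (s := s) (i := i)
    (sub_mem halt (Submodule.smul_mem _ _ (phi_mem_pairAlternating s i)))
    (sub_mem hsym (Submodule.smul_mem _ _ (phi_mem_outsideSymmetric s i))) ?_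
  simp [phi_baseEdge]

theorem permuteRep_swap_mem_pairAlternating (hw : w ∈ pairAlternating s i) {a b : V}
    (ha : a ∈ outsidePairs s i) (hb : b ∈ outsidePairs s i) :
    permuteRep (Equiv.swap a b) w ∈ pairAlternating s i := by
  refine mem_pairAlternating.2 fun j hj => ?_
  have hcomm := Equiv.mul_swap_eq_swap_mul (Equiv.swap a b) (s (Sum.inl j)) (s (Sum.inr j))
  rw [swap_apply_inl ha hb hj, swap_apply_inr ha hb hj] at hcomm
  rw [← Module.End.mul_apply, ← map_mul, ← hcomm, map_mul, Module.End.mul_apply,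
    mem_pairAlternating.1 hw j hj, map_neg]

theorem sub_permuteRep_swap_mem_pairAlternating_succ (hw : w ∈ pairAlternating s i) (hi : i < k) :
    w - permuteRep (Equiv.swap (s (Sum.inl ⟨i, hi⟩)) (s (Sum.inr ⟨i, hi⟩))) w ∈
      pairAlternating s (i + 1) := by
  refine mem_pairAlternating.2 fun j hj => ?_
  rcases Nat.lt_succ_iff_lt_or_eq.1 hj with hj | rfl
  · exact mem_pairAlternating.1 (sub_mem hw (permuteRep_swap_mem_pairAlternating hw
      (inl_mem_outsidePairs le_rfl) (inr_mem_outsidePairs le_rfl))) j hj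
  · rw [map_sub, ← Module.End.mul_apply, ← map_mul, Equiv.swap_mul_self, map_one,
      Module.End.one_apply, neg_sub]

theorem mem_outsideSymmetric_of_swap_first (hi : i < k) (h : ∀ a ∈ outsidePairs s i,
    permuteRep (Equiv.swap (s (Sum.inl ⟨i, hi⟩)) a) w = w) : w ∈ outsideSymmetric s i := by
  refine mem_outsideSymmetric.2 fun l hl a ha => ?_
  have hl' := h _ (inl_mem_outsidePairs hl)
  rcases eq_or_ne a (s (Sum.inl ⟨i, hi⟩)) with rfl | hai
  · rwa [Equiv.swap_comm]
  rcases eq_or_ne a (s (Sum.inl l)) with rfl | hal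
  · rw [Equiv.swap_self, ← Equiv.Perm.one_def, map_one, Module.End.one_apply]
  · rw [← Equiv.swap_mul_swap_mul_swap hai hal, map_mul, map_mul, Module.End.mul_apply,
      Module.End.mul_apply, hl', Equiv.swap_comm a, h a ha, hl']

theorem exists_mem_pairAlternating_succ {W : Submodule ℝ (WeightedHypergraph V k)}
    (hW : W ∈ permuteRep.invtSubmodule) (hw : w ∈ W) (halt : w ∈ pairAlternating s i)
    (hi : i < k) (hsym : w ∉ outsideSymmetric s i) :
    ∃ v ∈ W, v ≠ 0 ∧ v ∈ pairAlternating s (i + 1) := by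
  obtain ⟨a, ha, hne⟩ :
      ∃ a ∈ outsidePairs s i, permuteRep (Equiv.swap (s (Sum.inl ⟨i, hi⟩)) a) w ≠ w := by
    by_contra! h
    exact hsym (mem_outsideSymmetric_of_swap_first hi h)
  set x := s (Sum.inl ⟨i, hi⟩)
  set y := s (Sum.inr ⟨i, hi⟩)
  have hxy : x ≠ y := s.injective.ne Sum.inl_ne_inr
  have hxa : x ≠ a := fun hxa => hne (by
    rw [hxa, Equiv.swap_self, ← Equiv.Perm.one_def, map_one, Module.End.one_apply])
  -- Moving `a` to `y` turns the failing transposition into that of the next pair.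
  let v := permuteRep (Equiv.swap y a) w
  have hv : v ∈ W := apply_mem_of_mem_invtSubmodule hW _ hw
  refine ⟨v - permuteRep (Equiv.swap x y) v, sub_mem hv (apply_mem_of_mem_invtSubmodule hW _ hv),
    fun h => hne ?_, sub_permuteRep_swap_mem_pairAlternating_succ
      (permuteRep_swap_mem_pairAlternating halt (inr_mem_outsidePairs le_rfl) ha) hi⟩
  rw [Equiv.swap_comm x a, ← Equiv.swap_mul_swap_mul_swap hxy hxa, map_mul, map_mul,
    Module.End.mul_apply, Module.End.mul_apply, ← sub_eq_zero.1 h, ← Module.End.mul_apply,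
    ← map_mul, Equiv.swap_mul_self, map_one, Module.End.one_apply]

theorem exists_phi_mem_of_mem_pairAlternating {W : Submodule ℝ (WeightedHypergraph V k)}
    (hW : W ∈ permuteRep.invtSubmodule) (hi : i ≤ k) :
    ∀ v ∈ W, v ≠ 0 → v ∈ pairAlternating s i → ∃ j, phi s j ∈ W := by
  induction hi using Nat.decreasingInduction with
  | self =>
    intro v hv hv0 halt
    have hsym : v ∈ outsideSymmetric s k :=
      mem_outsideSymmetric.2 fun l hl => absurd l.2 hl.not_gt
    exact ⟨Fin.last k, mem_of_mem_span_singleton_of_ne_zero hv hv0 (mem_span_phi halt hsym)⟩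
  | of_succ i hi ih =>
    intro v hv hv0 halt
    by_cases hsym : v ∈ outsideSymmetric s i
    · exact ⟨⟨i, hi.trans k.lt_succ_self⟩,
        mem_of_mem_span_singleton_of_ne_zero hv hv0 (mem_span_phi halt hsym)⟩
    · obtain ⟨v', hv', hv'0, halt'⟩ := exists_mem_pairAlternating_succ hW hv halt hi hsym
      exact ih v' hv' hv'0 halt'

variable (s) in
theorem exists_phi_mem {W : Submodule ℝ (WeightedHypergraph V k)}
    (hW : W ∈ permuteRep.invtSubmodule) (hne : W ≠ ⊥) : ∃ j, phi s j ∈ W := by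
  obtain ⟨v, hv, hv0⟩ := Submodule.exists_mem_ne_zero_of_ne_bot hne
  exact exists_phi_mem_of_mem_pairAlternating hW k.zero_le v hv hv0
    (mem_pairAlternating.2 fun _ hj => absurd hj (Nat.not_lt_zero _))

end Phi

section Decomposition

variable {V : Type*} [Fintype V] [DecidableEq V] {k : ℕ} (s : Fin k ⊕ Fin k ↪ V)
  {W : Submodule ℝ (WeightedHypergraph V k)} {i j : Fin (k + 1)}

theorem phi_notMem_orthogonal {s} (h : phi s i ∈ W) : phi s i ∉ interForm.orthogonal W :=
  fun h' => phi_ne_zero s i (Submodule.disjoint_def.1 (disjoint_orthogonal W) _ h h')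

/-- The orthogonal projection to `W` commutes with permutations, so it maps `φ_i` to a weighting
with the same symmetries, that is, to a multiple of `φ_i`. -/
theorem phi_mem_or_phi_mem_orthogonal (hW : W ∈ permuteRep.invtSubmodule) (i : Fin (k + 1)) :
    phi s i ∈ W ∨ phi s i ∈ interForm.orthogonal W := by
  have hW' := orthogonal_interForm_mem_invtSubmodule hW
  obtain ⟨w, hw, p, hp, hwp⟩ : ∃ w ∈ W, ∃ p ∈ interForm.orthogonal W, w + p = phi s i :=
    Submodule.mem_sup.1 ((isCompl_orthogonal W).sup_eq_top ▸ Submodule.mem_top)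
  have heigen {π : Equiv.Perm V} {μ : ℝ} (h : phi s i ∈ Module.End.eigenspace (permuteRep π) μ) :
      w ∈ Module.End.eigenspace (permuteRep π) μ :=
    mem_eigenspace_of_add_mem_eigenspace (permuteRep.mem_invtSubmodule.1 hW π)
      (permuteRep.mem_invtSubmodule.1 hW' π) (disjoint_orthogonal W) hw hp (hwp ▸ h)
  have halt : w ∈ pairAlternating s i := by
    have := phi_mem_pairAlternating s i
    simp only [pairAlternating, Submodule.mem_iInf] at this ⊢
    exact fun j hj => heigen (this j hj)
  have hsym : w ∈ outsideSymmetric s i := by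
    have := phi_mem_outsideSymmetric s i
    simp only [outsideSymmetric, Submodule.mem_iInf] at this ⊢
    exact fun l hl a ha => heigen (this l hl a ha)
  rcases eq_or_ne w 0 with rfl | hw0
  · exact .inr (by rwa [← hwp, zero_add])
  · exact .inl (mem_of_mem_span_singleton_of_ne_zero hw hw0 (mem_span_phi halt hsym))

theorem phi_mem_orthogonal_degreeLE {m : ℕ} (hm : m < i) :
    phi s i ∈ interForm.orthogonal (degreeLE V k m) := by
  refine fun v hv => isRefl_interForm _ _
    (Submodule.span_le.2 ?_ hv : v ∈ LinearMap.ker (interForm (phi s i)))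
  rintro _ ⟨B, hB, rfl⟩
  obtain ⟨l, hl, hx, hy⟩ :=
    exists_pair_disjoint_of_card_lt s (Nat.lt_succ_iff.1 i.2) (lt_of_le_of_lt hB hm)
  let τ := Equiv.swap (s (Sum.inl l)) (s (Sum.inr l))
  have hfix : permuteRep τ (containing k B) = containing k B := by
    rw [permuteRep_containing, swap_smul_finset_eq_self (iff_of_false hx hy)]
  have hneg : permuteRep τ (phi s i) = -phi s i :=
    mem_pairAlternating.1 (phi_mem_pairAlternating s i) l hl
  have h := interForm_permuteRep τ (phi s i) (containing k B)
  rw [hfix, hneg, map_neg, LinearMap.neg_apply] at h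
  exact neg_eq_self.1 h

theorem phiSpan_le_orthogonal_of_lt (hij : i < j) :
    phiSpan s i ≤ interForm.orthogonal (phiSpan s j) := by
  have hdegree : phiSpan s i ≤ degreeLE V k i :=
    (phiSpan_le_iff (degreeLE_mem_invtSubmodule _)).2 (phi_mem_degreeLE s i)
  have horth : phiSpan s j ≤ interForm.orthogonal (degreeLE V k i) :=
    (phiSpan_le_iff (orthogonal_interForm_mem_invtSubmodule
      (degreeLE_mem_invtSubmodule _))).2 (phi_mem_orthogonal_degreeLE s hij)
  exact hdegree.trans ((le_orthogonal_comm isRefl_interForm).1 horth)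

theorem phiSpan_le_orthogonal_of_ne (hij : i ≠ j) :
    phiSpan s i ≤ interForm.orthogonal (phiSpan s j) := by
  rcases hij.lt_or_gt with h | h
  · exact phiSpan_le_orthogonal_of_lt s h
  · exact (le_orthogonal_comm isRefl_interForm).1 (phiSpan_le_orthogonal_of_lt s h)

theorem iInf_orthogonal_phiSpan : ⨅ j, interForm.orthogonal (phiSpan s j) = ⊥ := by
  have hinv : ⨅ j, interForm.orthogonal (phiSpan s j) ∈ permuteRep.invtSubmodule := by
    refine permuteRep.mem_invtSubmodule.2 fun π v hv => (Submodule.mem_iInf _).2 fun j => ?_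
    exact apply_mem_of_mem_invtSubmodule
      (orthogonal_interForm_mem_invtSubmodule (phiSpan_mem_invtSubmodule s j)) π
      ((Submodule.mem_iInf _).1 hv j)
  by_contra hne
  obtain ⟨i, hi⟩ := exists_phi_mem s hinv hne
  exact phi_notMem_orthogonal (phi_mem_phiSpan s i) ((Submodule.mem_iInf _).1 hi i)

omit [Fintype V] in
theorem le_phiSpan_of_phi_notMem [Finite V] (hW : W ∈ permuteRep.invtSubmodule)
    (h : ∀ j ≠ i, phi s j ∉ W) : W ≤ phiSpan s i := by
  cases nonempty_fintype V
  have horth (j) (hj : j ≠ i) : W ≤ interForm.orthogonal (phiSpan s j) := by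
    refine (le_orthogonal_comm isRefl_interForm).1 ((phiSpan_le_iff
      (orthogonal_interForm_mem_invtSubmodule hW)).2 ?_)
    exact (phi_mem_or_phi_mem_orthogonal s hW j).resolve_left (h j hj)
  intro u hu
  obtain ⟨w, hw, p, hp, rfl⟩ :
      ∃ w ∈ phiSpan s i, ∃ p ∈ interForm.orthogonal (phiSpan s i), w + p = u :=
    Submodule.mem_sup.1 ((isCompl_orthogonal (phiSpan s i)).sup_eq_top ▸ Submodule.mem_top)
  have hp_all : p ∈ ⨅ j, interForm.orthogonal (phiSpan s j) := by
    refine (Submodule.mem_iInf _).2 fun j => ?_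
    rcases eq_or_ne j i with rfl | hj
    · exact hp
    · exact (Submodule.add_mem_iff_right _ (phiSpan_le_orthogonal_of_ne s hj.symm hw)).1
        (horth j hj hu)
  rw [iInf_orthogonal_phiSpan, Submodule.mem_bot] at hp_all
  rwa [hp_all, add_zero]

theorem total_eq_zero_iff {w : WeightedHypergraph V k} :
    w.total = 0 ↔ w ∈ interForm.orthogonal (phiSpan s 0) := by
  have hone : orbitSpan permuteRep (1 : WeightedHypergraph V k) = Submodule.span ℝ {1} :=
    congrArg (Submodule.span ℝ)
      (Set.range_const : Set.range (fun _ : Equiv.Perm V => (1 : WeightedHypergraph V k)) = {1})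
  have htotal : interForm 1 w = w.total := one_dotProduct w
  change _ ↔ w ∈ interForm.orthogonal (orbitSpan permuteRep (phi s 0))
  rw [phi_zero, hone, LinearMap.BilinForm.orthogonal_span_singleton_eq_toLin_ker,
    LinearMap.mem_ker, ← htotal]
  rfl

theorem exists_perm_le_phiSpan {W : Fin k → Submodule ℝ (WeightedHypergraph V k)}
    (hW : ∀ m, W m ∈ permuteRep.invtSubmodule) (hne : ∀ m, W m ≠ ⊥)
    (hzero : ∀ m, W m ≤ interForm.orthogonal (phiSpan s 0))
    (horth : Pairwise fun m m' => W m ≤ interForm.orthogonal (W m')) :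
    ∃ σ : Equiv.Perm (Fin k), ∀ i, W (σ i) ≤ phiSpan s i.succ := by
  have hunique {m m' i} (h : phi s i ∈ W m) (h' : phi s i ∈ W m') : m = m' := by
    by_contra hmm'
    exact phi_notMem_orthogonal h' (horth hmm' h)
  have hphi_zero (m) : phi s 0 ∉ W m := fun h =>
    phi_notMem_orthogonal (phi_mem_phiSpan s 0) (hzero m h)
  have hex (m) : ∃ i : Fin k, phi s i.succ ∈ W m := by
    obtain ⟨j, hj⟩ := exists_phi_mem s (hW m) (hne m)
    have hj0 : j ≠ 0 := fun h => hphi_zero m (h ▸ hj)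
    obtain ⟨i, rfl⟩ := Fin.exists_succ_eq.2 hj0
    exact ⟨i, hj⟩
  choose f hf using hex
  have hf_inj : Function.Injective f := fun m m' h => hunique (hf m) (h ▸ hf m')
  obtain ⟨g, hg⟩ : ∃ g : Equiv.Perm (Fin k), ⇑g = f :=
    ⟨.ofBijective f hf_inj.bijective_of_finite, rfl⟩
  have hmem (i) : phi s i.succ ∈ W (g.symm i) := by simpa [← hg] using hf (g.symm i)
  refine ⟨g.symm, fun i => le_phiSpan_of_phi_notMem s (hW _) fun j hji hj => ?_⟩
  have hj0 : j ≠ 0 := fun h => hphi_zero _ (h ▸ hj)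
  obtain ⟨l, rfl⟩ := Fin.exists_succ_eq.2 hj0
  exact hji (congrArg Fin.succ (g.symm.injective (hunique (hmem l) hj)))

end Decomposition

end WeightedHypergraph


open WeightedHypergraph

theorem mainTheorem8 {V : Type*} [Fintype V] [DecidableEq V] (k : ℕ) (hk : 1 ≤ k)
    (hn : 2 * k ≤ Fintype.card V) (s : Fin k ⊕ Fin k ↪ V)
    (u : Fin k → WeightedHypergraph V k) (hu : ∀ i, u i ≠ 0) :
    ((∀ i, (u i).total = 0) ∧ ∀ i j, i < j → WeightedHypergraph.disc (u i) (u j) = 0) ↔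
      ∃ σ : Equiv.Perm (Fin k), ∀ i : Fin k,
        u (σ i) ∈ WeightedHypergraph.phiSpan s i.succ := by
  have hinv (m) : orbitSpan permuteRep (u m) ∈ permuteRep.invtSubmodule :=
    orbitSpan_mem_invtSubmodule permuteRep (u m)
  constructor
  · rintro ⟨htotal, hdisc⟩
    have hne (m) : orbitSpan permuteRep (u m) ≠ ⊥ := fun h =>
      hu m ((Submodule.mem_bot ℝ).1 (h ▸ self_mem_orbitSpan permuteRep (u m)))
    have hzero (m) : orbitSpan permuteRep (u m) ≤ interForm.orthogonal (phiSpan s 0) :=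
      (orbitSpan_le_iff (orthogonal_interForm_mem_invtSubmodule
        (phiSpan_mem_invtSubmodule s 0))).2 ((total_eq_zero_iff s).1 (htotal m))
    have horth {m m'} (h : m < m') := (disc_eq_zero_iff (htotal m)).1 (hdisc m m' h)
    obtain ⟨σ, hσ⟩ := exists_perm_le_phiSpan s hinv hne hzero fun m m' h =>
      h.lt_or_gt.elim horth fun h => (le_orthogonal_comm isRefl_interForm).1 (horth h)
    exact ⟨σ, fun i => hσ i (self_mem_orbitSpan permuteRep (u (σ i)))⟩
  · rintro ⟨σ, hσ⟩
    have hmem (m) : u m ∈ phiSpan s (σ.symm m).succ := by simpa using hσ (σ.symm m)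
    have hle (m) : orbitSpan permuteRep (u m) ≤ phiSpan s (σ.symm m).succ :=
      (orbitSpan_le_iff (phiSpan_mem_invtSubmodule s _)).2 (hmem m)
    have htotal (m) : (u m).total = 0 :=
      (total_eq_zero_iff s).2 (phiSpan_le_orthogonal_of_ne s (Fin.succ_ne_zero _) (hmem m))
    refine ⟨htotal, fun m m' h => (disc_eq_zero_iff (htotal m)).2 ?_⟩
    have hne : (σ.symm m).succ ≠ (σ.symm m').succ := by simpa using h.ne
    exact (hle m).trans ((phiSpan_le_orthogonal_of_ne s hne).trans
      (LinearMap.BilinForm.orthogonal_le (hle m')))
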